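/- Let $a,b,d$ be nonzero real constants and let $h=h(x)$ be a smooth real function. Consider the Karczewska--Rozmej--Rutkowski--Infeld (KRRI) equation $u_t=F$ with $$\begin{aligned}F={}&-u_x-\tfrac32 a\,uu_x-\tfrac16 b\,u_{xxx}+\tfrac38a^2u^2u_x-\tfrac{23}{24}ab\,u_xu_{xx}-\tfrac5{12}ab\,uu_{xxx}\\&+\tfrac d2(h'u+hu_x)+\tfrac14bd\,(-h'''u-h''u_x+h'u_{xx}+hu_{xxx})-\tfrac{19}{360}b^2u_{xxxxx}.\end{aligned}$$ Write $u_j$ for the $j$-th $x$-derivative of $u$. Let $\Omega$ be any open set of points $(t,x,u_0,u_1,\dots)$ (for the product topology) such that $h$ is smooth at the values of $x$ occurring in $\Omega$; for $h$ smooth on $\mathbb R$ one may take all of the jet space. Let $\mathcal A$ be the algebra of local functions on $\Omega$, that is, of smooth real functions of $t$, $x$ and finitely many of the $u_j$. On $\mathcal A$ put $D_x=\partial_x+\sum_{j\ge0}u_{j+1}\partial_{u_j}$ and $D_t=\partial_t+\sum_{j\ge0}D_x^j(F)\,\partial_{u_j}$. Let $\mathcal B$ be the algebra of formal series $L=\sum_{i=-\infty}^{k}a_iD^i$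 with $a_i\in\mathcal A$, with the product determined by $$aD^i\circ bD^j=a\sum_{k\ge0}\frac{i(i-1)\cdots(i-k+1)}{k!}\,D_x^k(b)\,D^{i+j-k},$$ with commutator $[A,B]=A\circ B-B\circ A$, and with $D_t$ acting on the coefficients. The degree $\deg L$ is the greatest $k$ such that the coefficient of $D^k$ in $L$ is not identically zero, and $\deg 0=-\infty$. Put $F_*=\sum_{i\ge0}\frac{\partial F}{\partial u_i}D^i$. A formal recursion operator (formal symmetry) of rank $k$ of the equation is a nonzero $L\in\mathcal B$ with $\deg L\neq0$ such that $$\deg\bigl(D_t(L)-[F_*,L]\bigr)\le\deg L+\deg F_*-k.$$ Then the KRRI equation has no formal recursion operator of rank $k$ for any integer $k>9$. -/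

import Mathlib

open scoped ContDiff

namespace KRRI

/-- The variables of local functions: `t`, `x` and `u j`, the `j`-th `x`-derivative of `u`. -/
inductive JetVar : Type
  | t : JetVar
  | x : JetVar
  | u (j : ℕ) : JetVar
  deriving DecidableEq

/-- A point of the infinite jet space, with the product topology: a value for each variable. -/
abbrev Jet : Type := JetVar → ℝ

variable {Ω : TopologicalSpace.Opens Jet}

/-- `f` is a smooth function of finitely many of the variables `t, x, u 0, u 1, …` on `Ω`. -/
def IsLocal (f : Ω → ℝ) : Prop :=
  ∃ (S : Finset JetVar) (g : (S → ℝ) → ℝ), ∀ p : Ω,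
    ContDiffAt ℝ ∞ g (S.restrict p.1) ∧ f p = g (S.restrict p.1)

/-- A local function may be written in terms of any larger finite set of variables. -/
lemma isLocal_enlarge {S T : Finset JetVar} (hST : S ⊆ T) {f : Ω → ℝ} {g : (S → ℝ) → ℝ}
    (hg : ∀ p : Ω, ContDiffAt ℝ ∞ g (S.restrict p.1) ∧ f p = g (S.restrict p.1)) :
    ∃ g' : (T → ℝ) → ℝ, ∀ p : Ω,
      ContDiffAt ℝ ∞ g' (T.restrict p.1) ∧ f p = g' (T.restrict p.1) := by
  refine ⟨fun q => g (fun i => q ⟨i.1, hST i.2⟩), fun p => ⟨?_, (hg p).2⟩⟩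
  have h1 : ContDiffAt ℝ ∞ (fun (q : T → ℝ) (i : S) => q ⟨i.1, hST i.2⟩) (T.restrict p.1) := by
    fun_prop
  exact ContDiffAt.comp (T.restrict p.1) (hg p).1 h1

/-- A smooth function of two local functions is local (used for sums and products). -/
lemma isLocal_comp₂ {f₁ f₂ : Ω → ℝ} (h₁ : IsLocal f₁) (h₂ : IsLocal f₂) {φ : ℝ → ℝ → ℝ}
    (hφ : ContDiff ℝ ∞ (fun q : ℝ × ℝ => φ q.1 q.2)) :
    IsLocal (fun p => φ (f₁ p) (f₂ p)) := by
  obtain ⟨S₁, g₁, hg₁⟩ := h₁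
  obtain ⟨S₂, g₂, hg₂⟩ := h₂
  obtain ⟨g₁', h₁'⟩ := isLocal_enlarge (Finset.subset_union_left (s₂ := S₂)) hg₁
  obtain ⟨g₂', h₂'⟩ := isLocal_enlarge (Finset.subset_union_right (s₁ := S₁)) hg₂
  refine ⟨S₁ ∪ S₂, fun q => φ (g₁' q) (g₂' q), fun p => ⟨?_, ?_⟩⟩
  · exact ContDiffAt.comp (f := fun q => (g₁' q, g₂' q)) _ hφ.contDiffAt
      ((h₁' p).1.prodMk (h₂' p).1)
  · change φ (f₁ p) (f₂ p) = _
    rw [(h₁' p).2, (h₂' p).2]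

variable (Ω) in
/-- The algebra of local functions on the open set `Ω` of the jet space. -/
def localFunctions : Subalgebra ℝ (Ω → ℝ) where
  carrier := {f | IsLocal f}
  mul_mem' h₁ h₂ := isLocal_comp₂ (φ := fun a b => a * b) h₁ h₂ (by fun_prop)
  add_mem' h₁ h₂ := isLocal_comp₂ (φ := fun a b => a + b) h₁ h₂ (by fun_prop)
  algebraMap_mem' r := ⟨∅, fun _ => r, fun _ => ⟨contDiffAt_const, rfl⟩⟩

/-- The partial derivative of a function on `Ω` with respect to the variable `v`.  (The value of
the extension of `f` outside `Ω` is irrelevant, since `Ω` is open.) -/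
noncomputable def partialDeriv (v : JetVar) (f : Ω → ℝ) (p : Ω) : ℝ :=
  deriv (fun s : ℝ => Function.extend Subtype.val f 0 (Function.update p.1 v s)) (p.1 v)

/-- Near `p`, the extension of `f` restricted to the `v`-line is given by `g`. -/
lemma extend_eventuallyEq (v : JetVar) {S : Finset JetVar} {f : Ω → ℝ} {g : (S → ℝ) → ℝ}
    (hg : ∀ p : Ω, f p = g (S.restrict p.1)) (p : Ω) :
    (fun s : ℝ => Function.extend Subtype.val f 0 (Function.update p.1 v s)) =ᶠ[nhds (p.1 v)]
      fun s => g (S.restrict (Function.update p.1 v s)) := by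
  have hc : Continuous (fun s : ℝ => Function.update p.1 v s) :=
    continuous_const.update v continuous_id
  have hm : ∀ᶠ s in nhds (p.1 v), Function.update p.1 v s ∈ Ω := by
    apply hc.continuousAt.eventually_mem
    rw [Function.update_eq_self]
    exact Ω.isOpen.mem_nhds p.2
  filter_upwards [hm] with s hs
  have h1 := Subtype.val_injective.extend_apply f (0 : Jet → ℝ) ⟨_, hs⟩
  exact h1.trans (hg ⟨_, hs⟩)

lemma partialDeriv_of_notMem {v : JetVar} {S : Finset JetVar} (hv : v ∉ S) {f : Ω → ℝ}
    {g : (S → ℝ) → ℝ} (hg : ∀ p : Ω, f p = g (S.restrict p.1)) (p : Ω) :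
    partialDeriv v f p = 0 := by
  rw [partialDeriv, (extend_eventuallyEq v hg p).deriv_eq]
  have h1 : (fun s : ℝ => g (S.restrict (Function.update p.1 v s))) =
      fun _ => g (S.restrict p.1) := by
    funext s
    congr 1
    funext i
    have hi : i.1 ≠ v := fun h => hv (h ▸ i.2)
    simp [Finset.restrict, Function.update_of_ne hi]
  rw [h1, deriv_const]

lemma isLocal_partialDeriv (v : JetVar) {f : Ω → ℝ} (hf : IsLocal f) :
    IsLocal (partialDeriv v f) := by
  obtain ⟨S, g, hg⟩ := hf
  by_cases hv : v ∈ S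
  · refine ⟨S, fun q => fderiv ℝ g q (Pi.single ⟨v, hv⟩ 1), fun p => ⟨?_, ?_⟩⟩
    · exact ((hg p).1.fderiv_right (m := ∞) le_rfl).clm_apply contDiffAt_const
    · rw [partialDeriv, (extend_eventuallyEq v (fun p => (hg p).2) p).deriv_eq]
      have h1 : (fun s : ℝ => g (S.restrict (Function.update p.1 v s))) =
          g ∘ Function.update (S.restrict p.1) ⟨v, hv⟩ := by
        funext s
        simp only [Function.comp]
        congr 1
        funext i
        by_cases hi : i = ⟨v, hv⟩
        · subst hi
          simp [Finset.restrict]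
        · have hi' : i.1 ≠ v := fun h => hi (Subtype.ext h)
          simp [Finset.restrict, Function.update_of_ne hi, Function.update_of_ne hi']
      have h2 : Function.update (S.restrict p.1) ⟨v, hv⟩ (p.1 v) = S.restrict p.1 :=
        Function.update_eq_self (⟨v, hv⟩ : S) (S.restrict p.1)
      have h3 : HasFDerivAt g (fderiv ℝ g (S.restrict p.1))
          (Function.update (S.restrict p.1) ⟨v, hv⟩ (p.1 v)) := by
        rw [h2]
        exact ((hg p).1.differentiableAt (by simp)).hasFDerivAt
      rw [h1]
      exact (h3.comp_hasDerivAt (p.1 v)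
        (hasDerivAt_update (S.restrict p.1) (⟨v, hv⟩ : S) (p.1 v))).deriv
  · refine ⟨∅, fun _ => 0, fun p => ⟨contDiffAt_const, ?_⟩⟩
    exact partialDeriv_of_notMem hv (fun p => (hg p).2) p

/-- The partial derivative `∂/∂v` on local functions. -/
noncomputable def pd (v : JetVar) (f : localFunctions Ω) : localFunctions Ω :=
  ⟨partialDeriv v f.1, isLocal_partialDeriv v f.2⟩

lemma pd_zero (v : JetVar) : pd v (0 : localFunctions Ω) = 0 := by
  apply Subtype.ext
  funext p
  exact partialDeriv_of_notMem (S := ∅) (g := fun _ => 0) (by simp) (fun _ => rfl) p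

variable (Ω) in
/-- The variable `v`, as a local function. -/
def coord (v : JetVar) : localFunctions Ω :=
  ⟨fun p => p.1 v, {v}, fun q => q ⟨v, Finset.mem_singleton_self v⟩,
    fun _ => ⟨by fun_prop, rfl⟩⟩

/-- A function `h(x)` of `x` alone, as a local function; it has to be smooth at the values that
`x` takes in `Ω`. -/
def ofX (h : ℝ → ℝ) (hh : ∀ p ∈ Ω, ContDiffAt ℝ ∞ h (p JetVar.x)) : localFunctions Ω :=
  ⟨fun p => h (p.1 JetVar.x), {JetVar.x},
    fun q => h (q ⟨JetVar.x, Finset.mem_singleton_self _⟩),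
    fun p => ⟨ContDiffAt.comp (f := fun q : (({JetVar.x} : Finset JetVar) → ℝ) =>
      q ⟨JetVar.x, Finset.mem_singleton_self _⟩) _ (hh p.1 p.2) (by fun_prop), rfl⟩⟩

/-- The total derivative `D_x = ∂/∂x + ∑ⱼ u_{j+1} ∂/∂u_j` (a finite sum on each local function). -/
noncomputable def totalDx (f : localFunctions Ω) : localFunctions Ω :=
  pd .x f + ∑ᶠ j : ℕ, coord Ω (.u (j + 1)) * pd (.u j) f

/-- The total derivative `D_t = ∂/∂t + ∑ⱼ D_x^j(F) ∂/∂u_j` restricted to `u_t = F`. -/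
noncomputable def totalDt (F f : localFunctions Ω) : localFunctions Ω :=
  pd .t f + ∑ᶠ j : ℕ, totalDx^[j] F * pd (.u j) f

lemma totalDx_zero : totalDx (0 : localFunctions Ω) = 0 := by
  simp [totalDx, pd_zero]

lemma totalDt_zero (F : localFunctions Ω) : totalDt F 0 = 0 := by
  simp [totalDt, pd_zero]

variable (Ω) in
/-- Formal series `∑_{i ≤ k} a_i D^i` with local coefficients; `L.1 i` is the coefficient of
`D^i` in `L`. -/
def FormalSeries : AddSubgroup (ℤ → localFunctions Ω) where
  carrier := {L | ∃ N : ℤ, ∀ i > N, L i = 0}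
  zero_mem' := ⟨0, fun _ _ => rfl⟩
  add_mem' := by
    rintro A B ⟨M, hM⟩ ⟨N, hN⟩
    refine ⟨max M N, fun i hi => ?_⟩
    rw [Pi.add_apply, hM i (lt_of_le_of_lt (le_max_left _ _) hi),
      hN i (lt_of_le_of_lt (le_max_right _ _) hi), add_zero]
  neg_mem' := by
    rintro A ⟨M, hM⟩
    exact ⟨M, fun i hi => by rw [Pi.neg_apply, hM i hi, neg_zero]⟩

/-- The product determined by
`a D^i ∘ b D^j = ∑ₖ (i(i-1)⋯(i-k+1)/k!) a D_x^k(b) D^{i+j-k}`: the coefficient of `D^n` is the sum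
(with finitely many nonzero terms) over all `i ∈ ℤ`, `k ∈ ℕ` of the terms with `j = n - i + k`. -/
noncomputable def FormalSeries.comp (A B : FormalSeries Ω) : FormalSeries Ω :=
  ⟨fun n => ∑ᶠ q : ℤ × ℕ,
      Ring.choose q.1 q.2 • (A.1 q.1 * totalDx^[q.2] (B.1 (n - q.1 + q.2))), by
    obtain ⟨M, hM⟩ := A.2
    obtain ⟨N, hN⟩ := B.2
    refine ⟨M + N, fun n hn => ?_⟩
    refine finsum_eq_zero_of_forall_eq_zero fun q => ?_
    by_cases hq : q.1 > M
    · rw [hM _ hq, zero_mul, smul_zero]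
    · rw [hN (n - q.1 + q.2) (by lia), Function.iterate_fixed totalDx_zero, mul_zero,
        smul_zero]⟩

/-- The commutator `[A, B] = A ∘ B - B ∘ A`. -/
noncomputable def FormalSeries.commutator (A B : FormalSeries Ω) : FormalSeries Ω :=
  comp A B - comp B A

/-- `D_t` acting on formal series coefficientwise. -/
noncomputable def FormalSeries.dt (F : localFunctions Ω) (L : FormalSeries Ω) : FormalSeries Ω :=
  ⟨fun i => totalDt F (L.1 i), by
    obtain ⟨N, hN⟩ := L.2
    exact ⟨N, fun i hi => by simp only [hN i hi, totalDt_zero]⟩⟩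

open Classical in
/-- The degree: the greatest `k` such that the coefficient of `D^k` is not (identically) zero,
and `⊥` (standing for `-∞`) for the zero series. -/
noncomputable def FormalSeries.deg (L : FormalSeries Ω) : WithBot ℤ :=
  if L = 0 then ⊥ else ((sSup {i : ℤ | L.1 i ≠ 0} : ℤ) : WithBot ℤ)

/-- The linearization `f_* = ∑_{i ≥ 0} (∂f/∂u_i) D^i` of a local function. -/
noncomputable def linearization (f : localFunctions Ω) : FormalSeries Ω :=
  ⟨fun i => if 0 ≤ i then pd (.u i.toNat) f else 0, by
    obtain ⟨S, g, hg⟩ := f.2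
    refine ⟨∑ v ∈ S, (match v with | .u j => (j : ℤ) | _ => 0), fun i hi => ?_⟩
    have hnn : ∀ v ∈ S, (0 : ℤ) ≤ (match v with | .u j => (j : ℤ) | _ => 0) := by
      intro v _
      cases v <;> simp
    have h0 : 0 ≤ i := (Finset.sum_nonneg hnn).trans hi.le
    simp only [if_pos h0]
    apply Subtype.ext
    funext p
    refine partialDeriv_of_notMem (S := S) (fun hv => ?_) (fun p => (hg p).2) p
    have h1 := Finset.single_le_sum hnn hv
    simp only [Int.toNat_of_nonneg h0] at h1
    lia⟩

/-- `L` is a formal recursion operator (formal symmetry) of rank `k` of the evolution equation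
`u_t = F`: a nonzero series of nonzero degree with
`deg (D_t(L) - [F_*, L]) ≤ deg L + deg F_* - k`. -/
def IsFormalRecursionOperator (F : localFunctions Ω) (k : ℤ) (L : FormalSeries Ω) : Prop :=
  L ≠ 0 ∧ FormalSeries.deg L ≠ 0 ∧
    FormalSeries.deg (FormalSeries.dt F L - FormalSeries.commutator (linearization F) L) + k ≤
      FormalSeries.deg L + FormalSeries.deg (linearization F)

/-- The right-hand side of the Karczewska–Rozmej–Rutkowski–Infeld equation with constants
`a, b, d` and depth function `h`. -/
noncomputable def krriRHS (a b d : ℝ) (h : ℝ → ℝ)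
    (hh : ∀ p ∈ Ω, ContDiffAt ℝ ∞ h (p JetVar.x)) : localFunctions Ω :=
  let u : ℕ → localFunctions Ω := fun j => coord Ω (.u j)
  let H : ℕ → localFunctions Ω := fun j => (pd .x)^[j] (ofX h hh);
  - u 1 - (3 / 2 * a) • (u 0 * u 1) - (1 / 6 * b) • u 3
    + (3 / 8 * a ^ 2) • (u 0 ^ 2 * u 1) - (23 / 24 * a * b) • (u 1 * u 2)
    - (5 / 12 * a * b) • (u 0 * u 3)
    + (d / 2) • (H 1 * u 0 + H 0 * u 1)
    + (1 / 4 * b * d) • (-(H 3 * u 0) - H 2 * u 1 + H 1 * u 2 + H 0 * u 3)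
    - (19 / 360 * b ^ 2) • u 5

end KRRI

/-! Give `u j` weight `j + 2` and functions of `t, x` weight `0`. Then `F` has weight 7, and its
weight 7 part `Φ` consists of the constant-coefficient terms in `u₅`, `u₁u₂`, `u₀u₃`, `u₀²u₁`; all
terms with `h` have lower weight.

Write `L = ∑ A_r D^(m-r)`. Rank above 9 forces the coefficients of `D^(m+4-s)` in `D_t(L) - [F_*,
L]` to vanish for `0 ≤ s ≤ 8`. The newest unknown in equation `s` is `A_s`, entering only as a
constant multiple of `D_x A_s`; equation 0 says that `c = A_0` satisfies `D_x c = 0`. For `Φ` alone,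
an explicit homogeneous `P` with `P_0 = 1` solves equations 1 to 7 and leaves `γ u₁³` in equation 8,
with `γ ≠ 0` because `m ≠ 0` (`symmetryDefect_top`, `symmetryDefect_top_eight`). Comparing the two
systems, `A_r - c P_r` has weight at most `r - 1` for `r < 8` (`jetDefect_sub`, `HasWeight.of_Dx`).
Equation 8 then makes `γ c u₁³` a total derivative modulo weight 8, which forces `c = 0`
(`eq_zero_of_Dx_sub_mul_coord_one_pow`), although `c` is the leading coefficient of `L`.

Division is only by nonzero reals, so zeros of `c` or a disconnected `Ω` do no harm. -/

namespace KRRI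

variable {Ω : TopologicalSpace.Opens Jet}

/-! ### Partial derivatives as commuting derivations -/

/-- `g` represents the local function `f` in terms of the variables in `S`. -/
def Represents (S : Finset JetVar) (g : (S → ℝ) → ℝ) (f : Ω → ℝ) : Prop :=
  ∀ p : Ω, ContDiffAt ℝ ∞ g (S.restrict p.1) ∧ f p = g (S.restrict p.1)

lemma exists_represents (T : Finset JetVar) (f : localFunctions Ω) :
    ∃ S, T ⊆ S ∧ ∃ g, Represents S g f.1 := by
  obtain ⟨S, g, hg⟩ := f.2
  exact ⟨T ∪ S, Finset.subset_union_left, isLocal_enlarge Finset.subset_union_right hg⟩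

lemma exists_represents₂ (T : Finset JetVar) (f f' : localFunctions Ω) :
    ∃ S, T ⊆ S ∧ (∃ g, Represents S g f.1) ∧ ∃ g, Represents S g f'.1 := by
  obtain ⟨S, hS, g, hg⟩ := exists_represents T f
  obtain ⟨S', hS', g', hg'⟩ := exists_represents S f'
  exact ⟨S', hS.trans hS', isLocal_enlarge hS' hg, g', hg'⟩

lemma Represents.partialDeriv_eq {S : Finset JetVar} {g : (S → ℝ) → ℝ} {f : Ω → ℝ}
    (hg : Represents S g f) {v : JetVar} (hv : v ∈ S) (p : Ω) :
    partialDeriv v f p = fderiv ℝ g (S.restrict p.1) (Pi.single ⟨v, hv⟩ 1) := by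
  rw [partialDeriv, (extend_eventuallyEq v (fun p => (hg p).2) p).deriv_eq]
  have h1 : (fun s : ℝ => g (S.restrict (Function.update p.1 v s))) =
      g ∘ Function.update (S.restrict p.1) ⟨v, hv⟩ := by
    funext s
    simp only [Function.comp]
    congr 1
    funext i
    by_cases hi : i = ⟨v, hv⟩
    · subst hi
      simp [Finset.restrict]
    · have hi' : i.1 ≠ v := fun h => hi (Subtype.ext h)
      simp [Finset.restrict, Function.update_of_ne hi, Function.update_of_ne hi']
  have h2 : Function.update (S.restrict p.1) ⟨v, hv⟩ (p.1 v) = S.restrict p.1 :=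
    Function.update_eq_self (⟨v, hv⟩ : S) (S.restrict p.1)
  have h3 : HasFDerivAt g (fderiv ℝ g (S.restrict p.1))
      (Function.update (S.restrict p.1) ⟨v, hv⟩ (p.1 v)) := by
    rw [h2]
    exact ((hg p).1.differentiableAt (by simp)).hasFDerivAt
  rw [h1]
  exact (h3.comp_hasDerivAt (p.1 v)
    (hasDerivAt_update (S.restrict p.1) (⟨v, hv⟩ : S) (p.1 v))).deriv

lemma Represents.partialDeriv {S : Finset JetVar} {g : (S → ℝ) → ℝ} {f : Ω → ℝ}
    (hg : Represents S g f) {v : JetVar} (hv : v ∈ S) :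
    Represents S (fun q => fderiv ℝ g q (Pi.single ⟨v, hv⟩ 1)) (partialDeriv v f) :=
  fun p => ⟨((hg p).1.fderiv_right (m := ∞) le_rfl).clm_apply contDiffAt_const,
    hg.partialDeriv_eq hv p⟩

lemma Represents.differentiableAt {S : Finset JetVar} {g : (S → ℝ) → ℝ} {f : Ω → ℝ}
    (hg : Represents S g f) (p : Ω) : DifferentiableAt ℝ g (S.restrict p.1) :=
  (hg p).1.differentiableAt (by simp)

lemma Represents.add {S : Finset JetVar} {g g' : (S → ℝ) → ℝ} {f f' : Ω → ℝ}
    (hg : Represents S g f) (hg' : Represents S g' f') :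
    Represents S (fun q => g q + g' q) (f + f') :=
  fun p => ⟨(hg p).1.add (hg' p).1, by rw [Pi.add_apply, (hg p).2, (hg' p).2]⟩

lemma Represents.mul {S : Finset JetVar} {g g' : (S → ℝ) → ℝ} {f f' : Ω → ℝ}
    (hg : Represents S g f) (hg' : Represents S g' f') :
    Represents S (fun q => g q * g' q) (f * f') :=
  fun p => ⟨(hg p).1.mul (hg' p).1, by rw [Pi.mul_apply, (hg p).2, (hg' p).2]⟩

lemma pd_add (v : JetVar) (f f' : localFunctions Ω) : pd v (f + f') = pd v f + pd v f' := by
  obtain ⟨S, hS, ⟨g, hg⟩, g', hg'⟩ := exists_represents₂ {v} f f'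
  have hv : v ∈ S := hS (by simp)
  apply Subtype.ext
  funext p
  change partialDeriv v (f.1 + f'.1) p = partialDeriv v f.1 p + partialDeriv v f'.1 p
  rw [(hg.add hg').partialDeriv_eq hv, hg.partialDeriv_eq hv, hg'.partialDeriv_eq hv,
    fderiv_fun_add (hg.differentiableAt p) (hg'.differentiableAt p)]
  rfl

lemma pd_mul (v : JetVar) (f f' : localFunctions Ω) :
    pd v (f * f') = f * pd v f' + f' * pd v f := by
  obtain ⟨S, hS, ⟨g, hg⟩, g', hg'⟩ := exists_represents₂ {v} f f'
  have hv : v ∈ S := hS (by simp)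
  apply Subtype.ext
  funext p
  change partialDeriv v (f.1 * f'.1) p =
    f.1 p * partialDeriv v f'.1 p + f'.1 p * partialDeriv v f.1 p
  rw [(hg.mul hg').partialDeriv_eq hv, hg.partialDeriv_eq hv, hg'.partialDeriv_eq hv,
    fderiv_fun_mul (hg.differentiableAt p) (hg'.differentiableAt p), (hg p).2, (hg' p).2]
  rfl

lemma pd_algebraMap (v : JetVar) (r : ℝ) : pd v (algebraMap ℝ (localFunctions Ω) r) = 0 := by
  apply Subtype.ext
  funext p
  exact partialDeriv_of_notMem (S := ∅) (g := fun _ => r) (by simp) (fun _ => rfl) p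

lemma pd_smul (v : JetVar) (r : ℝ) (f : localFunctions Ω) : pd v (r • f) = r • pd v f := by
  rw [Algebra.smul_def, pd_mul, pd_algebraMap, mul_zero, add_zero, Algebra.smul_def]

lemma pd_comm (v w : JetVar) (f : localFunctions Ω) : pd v (pd w f) = pd w (pd v f) := by
  obtain ⟨S, hS, g, hg⟩ := exists_represents {v, w} f
  have hv : v ∈ S := hS (by simp)
  have hw : w ∈ S := hS (by simp)
  apply Subtype.ext
  funext p
  change partialDeriv v (partialDeriv w f.1) p = partialDeriv w (partialDeriv v f.1) p
  rw [(hg.partialDeriv hw).partialDeriv_eq hv, (hg.partialDeriv hv).partialDeriv_eq hw]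
  have hd : DifferentiableAt ℝ (fderiv ℝ g) (S.restrict p.1) :=
    ((hg p).1.fderiv_right (m := ∞) le_rfl).differentiableAt (by simp)
  have hs := (hg p).1.isSymmSndFDerivAt (by
    rw [minSmoothness_of_isRCLikeNormedField]
    exact WithTop.coe_le_coe.2 (le_top : (2 : ℕ∞) ≤ ⊤))
  rw [fderiv_clm_apply hd (differentiableAt_const _),
    fderiv_clm_apply hd (differentiableAt_const _)]
  simpa using hs.eq (Pi.single ⟨v, hv⟩ 1) (Pi.single ⟨w, hw⟩ 1)

/-- The partial derivative as a derivation. -/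
noncomputable def pdDer (v : JetVar) : Derivation ℝ (localFunctions Ω) (localFunctions Ω) :=
  Derivation.mk' { toFun := pd v, map_add' := pd_add v, map_smul' := pd_smul v } (pd_mul v)

lemma pdDer_apply (v : JetVar) (f : localFunctions Ω) : pdDer v f = pd v f := rfl

lemma pd_coord_self (v : JetVar) : pd v (coord Ω v) = 1 := by
  apply Subtype.ext
  funext p
  have h : Represents {v} (fun q => q ⟨v, Finset.mem_singleton_self v⟩) (coord Ω v).1 :=
    fun _ => ⟨by fun_prop, rfl⟩
  change partialDeriv v (coord Ω v).1 p = 1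
  rw [h.partialDeriv_eq (Finset.mem_singleton_self v)]
  have h1 := (ContinuousLinearMap.proj (R := ℝ) (φ := fun _ : ({v} : Finset JetVar) => ℝ)
    ⟨v, Finset.mem_singleton_self v⟩).fderiv (x := Finset.restrict {v} p.1)
  exact (congrArg (fun l => l (Pi.single ⟨v, Finset.mem_singleton_self v⟩ 1)) h1).trans
    (Pi.single_eq_same (M := fun _ : ({v} : Finset JetVar) => ℝ) _ _)

lemma pd_coord_of_ne {v w : JetVar} (h : v ≠ w) : pd v (coord Ω w) = 0 := by
  apply Subtype.ext
  funext p
  exact partialDeriv_of_notMem (S := {w}) (g := fun q => q ⟨w, Finset.mem_singleton_self w⟩)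
    (by simpa using h) (fun _ => rfl) p

lemma pd_u_coord (i j : ℕ) : pd (.u i) (coord Ω (.u j)) = if i = j then 1 else 0 := by
  split_ifs with h
  · rw [h, pd_coord_self]
  · exact pd_coord_of_ne (by simpa using h)

/-! ### Total derivatives as derivations -/

lemma exists_forall_pd_u_eq_zero (f : localFunctions Ω) :
    ∃ N : ℕ, ∀ j ≥ N, pd (.u j) f = 0 := by
  obtain ⟨S, g, hg⟩ := f.2
  obtain ⟨N, hN⟩ := ((S.finite_toSet.preimage
    (f := JetVar.u) (fun i _ j _ h => JetVar.u.inj h))).bddAbove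
  refine ⟨N + 1, fun j hj => ?_⟩
  apply Subtype.ext
  funext p
  refine partialDeriv_of_notMem (S := S) (fun hv => ?_) (fun p => (hg p).2) p
  exact absurd (hN hv) (by lia)

lemma finsum_mul_pd_eq (G : ℕ → localFunctions Ω) {f : localFunctions Ω} {N : ℕ}
    (hN : ∀ j ≥ N, pd (.u j) f = 0) :
    ∑ᶠ j, G j * pd (.u j) f = ∑ j ∈ Finset.range N, G j * pd (.u j) f := by
  apply finsum_eq_sum_of_support_subset
  intro j hj
  by_contra h
  exact hj (by simp [hN j (by simpa using h)])

/-- The derivation `∑ⱼ G_j ∂/∂u_j`. -/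
noncomputable def evolDer (G : ℕ → localFunctions Ω) :
    Derivation ℝ (localFunctions Ω) (localFunctions Ω) :=
  Derivation.mk'
    { toFun := fun f => ∑ᶠ j, G j * pd (.u j) f
      map_add' := fun f f' => by
        obtain ⟨N, hN⟩ := exists_forall_pd_u_eq_zero f
        obtain ⟨N', hN'⟩ := exists_forall_pd_u_eq_zero f'
        have h1 : ∀ j ≥ max N N', pd (.u j) f = 0 := fun j hj => hN j (le_of_max_le_left hj)
        have h2 : ∀ j ≥ max N N', pd (.u j) f' = 0 := fun j hj => hN' j (le_of_max_le_right hj)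
        rw [finsum_mul_pd_eq G h1, finsum_mul_pd_eq G h2,
          finsum_mul_pd_eq G (N := max N N') (fun j hj => by
            rw [pd_add, h1 j hj, h2 j hj, add_zero]), ← Finset.sum_add_distrib]
        exact Finset.sum_congr rfl fun j _ => by rw [pd_add, mul_add]
      map_smul' := fun r f => by
        obtain ⟨N, hN⟩ := exists_forall_pd_u_eq_zero f
        rw [finsum_mul_pd_eq G hN, finsum_mul_pd_eq G (N := N) (fun j hj => by
            rw [pd_smul, hN j hj, smul_zero]), RingHom.id_apply, Finset.smul_sum]
        exact Finset.sum_congr rfl fun j _ => by rw [pd_smul, mul_smul_comm] }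
    (fun f f' => by
      obtain ⟨N, hN⟩ := exists_forall_pd_u_eq_zero f
      obtain ⟨N', hN'⟩ := exists_forall_pd_u_eq_zero f'
      have h1 : ∀ j ≥ max N N', pd (.u j) f = 0 := fun j hj => hN j (le_of_max_le_left hj)
      have h2 : ∀ j ≥ max N N', pd (.u j) f' = 0 := fun j hj => hN' j (le_of_max_le_right hj)
      change ∑ᶠ j, G j * pd (.u j) (f * f') =
        f * ∑ᶠ j, G j * pd (.u j) f' + f' * ∑ᶠ j, G j * pd (.u j) f
      rw [finsum_mul_pd_eq G h1, finsum_mul_pd_eq G h2,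
        finsum_mul_pd_eq G (N := max N N') (fun j hj => by
          rw [pd_mul, h1 j hj, h2 j hj, mul_zero, mul_zero, add_zero]),
        Finset.mul_sum, Finset.mul_sum, ← Finset.sum_add_distrib]
      exact Finset.sum_congr rfl fun j _ => by rw [pd_mul]; ring)

lemma evolDer_apply (G : ℕ → localFunctions Ω) (f : localFunctions Ω) :
    evolDer G f = ∑ᶠ j, G j * pd (.u j) f := rfl

variable (Ω) in
/-- The total derivative `D_x` as a derivation. -/
noncomputable def Dx : Derivation ℝ (localFunctions Ω) (localFunctions Ω) :=
  pdDer .x + evolDer fun j => coord Ω (.u (j + 1))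

/-- The total derivative `D_t` as a derivation. -/
noncomputable def Dt (F : localFunctions Ω) :
    Derivation ℝ (localFunctions Ω) (localFunctions Ω) :=
  pdDer .t + evolDer fun j => (Dx Ω)^[j] F

lemma totalDt_eq (F : localFunctions Ω) : totalDt F = Dt F := rfl

lemma Dx_apply (f : localFunctions Ω) :
    Dx Ω f = pd .x f + evolDer (fun j => coord Ω (.u (j + 1))) f := rfl

lemma Dt_apply (F f : localFunctions Ω) :
    Dt F f = pd .t f + evolDer (fun j => (Dx Ω)^[j] F) f := rfl

lemma evolDer_coord (G : ℕ → localFunctions Ω) (j : ℕ) : evolDer G (coord Ω (.u j)) = G j := by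
  rw [evolDer_apply, finsum_eq_single _ j]
  · simp [pd_u_coord]
  · intro i hi
    simp [pd_u_coord, hi]

@[simp]
lemma Dx_coord (j : ℕ) : Dx Ω (coord Ω (.u j)) = coord Ω (.u (j + 1)) := by
  rw [Dx_apply, evolDer_coord, pd_coord_of_ne (by simp), zero_add]

@[simp]
lemma Dt_coord (F : localFunctions Ω) (j : ℕ) : Dt F (coord Ω (.u j)) = (Dx Ω)^[j] F := by
  rw [Dt_apply, evolDer_coord, pd_coord_of_ne (by simp), zero_add]

lemma pd_evolDer (v : JetVar) (G : ℕ → localFunctions Ω) (f : localFunctions Ω) :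
    pd v (evolDer G f) = evolDer G (pd v f) + evolDer (fun j => pd v (G j)) f := by
  obtain ⟨N, hN⟩ := exists_forall_pd_u_eq_zero f
  rw [evolDer_apply, evolDer_apply, evolDer_apply, finsum_mul_pd_eq _ hN, finsum_mul_pd_eq _ hN,
    finsum_mul_pd_eq _ (N := N) (fun j hj => by rw [pd_comm, hN j hj, pd_zero]),
    ← pdDer_apply, map_sum, ← Finset.sum_add_distrib]
  exact Finset.sum_congr rfl fun j _ => by
    rw [pdDer_apply, pd_mul, pd_comm v]; ring

/-- The extra term arises because `u (j + 1)` is the coefficient of `∂/∂u_j` in `D_x`. -/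
lemma pd_u_succ_Dx (j : ℕ) (f : localFunctions Ω) :
    pd (.u (j + 1)) (Dx Ω f) = Dx Ω (pd (.u (j + 1)) f) + pd (.u j) f := by
  rw [Dx_apply, Dx_apply, pd_add, pd_evolDer, pd_comm, add_assoc]
  congr 2
  rw [evolDer_apply, finsum_eq_single _ j]
  · simp [pd_u_coord]
  · intro i hi
    simp [pd_u_coord, hi.symm]

lemma pd_u_zero_Dx (f : localFunctions Ω) :
    pd (.u 0) (Dx Ω f) = Dx Ω (pd (.u 0) f) := by
  rw [Dx_apply, Dx_apply, pd_add, pd_evolDer, pd_comm]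
  simp [pd_u_coord, evolDer_apply]

/-! ### The weight filtration -/

/-- `f` has weight at most `n`, where `u j` has weight `j + 2` and functions of `t` and `x` have
weight `0`: all iterated derivatives of `f` along `u j₁, …, u jᵣ` of total weight larger than `n`
vanish. -/
def HasWeight (n : ℤ) (f : localFunctions Ω) : Prop :=
  ∀ l : List ℕ, n < (l.map fun j : ℕ => (j : ℤ) + 2).sum → l.foldl (fun g j => pd (.u j) g) f = 0

/-- Splits off the first entry of the list; the empty list accounts for negative `n`. This recursive
form drives the inductions on weight below. -/
lemma hasWeight_iff {n : ℤ} {f : localFunctions Ω} :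
    HasWeight n f ↔ (n < 0 → f = 0) ∧ ∀ j : ℕ, HasWeight (n - (j + 2)) (pd (.u j) f) := by
  constructor
  · intro h
    refine ⟨fun hn => h [] (by simpa using hn), fun j l hl => h (j :: l) ?_⟩
    simp only [List.map_cons, List.sum_cons]
    linarith
  · rintro ⟨h0, h1⟩ (_ | ⟨j, l⟩) hl
    · exact h0 (by simpa using hl)
    · refine h1 j l ?_
      simp only [List.map_cons, List.sum_cons] at hl
      linarith

namespace HasWeight

lemma eq_zero {n : ℤ} {f : localFunctions Ω} (h : HasWeight n f) (hn : n < 0) : f = 0 :=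
  (hasWeight_iff.1 h).1 hn

lemma pd_u {n : ℤ} {f : localFunctions Ω} (h : HasWeight n f) (j : ℕ) :
    HasWeight (n - (j + 2)) (pd (.u j) f) :=
  (hasWeight_iff.1 h).2 j

lemma mono {n n' : ℤ} {f : localFunctions Ω} (h : HasWeight n f) (hn : n ≤ n') :
    HasWeight n' f :=
  fun l hl => h l (lt_of_le_of_lt hn hl)

lemma zero (n : ℤ) : HasWeight n (0 : localFunctions Ω) := by
  intro l h
  clear h
  induction l with
  | nil => rfl
  | cons j l ih => rw [List.foldl_cons, pd_zero]; exact ih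

end HasWeight

/-- Induction principle for statements about elements of weight at most `n`. -/
lemma weight_induction {p : ℤ → Prop} (hneg : ∀ n < 0, p n)
    (hstep : ∀ n, 0 ≤ n → (∀ k < n, p k) → p n) (n : ℤ) : p n := by
  have key : ∀ N : ℕ, ∀ n : ℤ, n < N → p n := by
    intro N
    induction N with
    | zero => exact fun n hn => hneg n (by simpa using hn)
    | succ N ih =>
      intro n hn
      rcases lt_or_ge n 0 with h | h
      · exact hneg n h
      · exact hstep n h fun k hk => ih k (by push_cast at hn; lia)
  exact key (n.toNat + 1) n (by push_cast; lia)

namespace HasWeight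

lemma add {n : ℤ} {f g : localFunctions Ω} (hf : HasWeight n f) (hg : HasWeight n g) :
    HasWeight n (f + g) := by
  induction n using weight_induction generalizing f g with
  | hneg n hn => rw [hf.eq_zero hn, hg.eq_zero hn, add_zero]; exact zero n
  | hstep n hn ih =>
    refine hasWeight_iff.2 ⟨fun h => by lia, fun j => ?_⟩
    rw [pd_add]
    exact ih _ (by lia) (hf.pd_u j) (hg.pd_u j)

lemma mul {n m : ℤ} {f g : localFunctions Ω} (hf : HasWeight n f) (hg : HasWeight m g) :
    HasWeight (n + m) (f * g) := by
  -- The induction is on the total weight, with `n` and `m` free, because the Leibniz rule may lower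
  -- either one. A factor with a negative bound is zero and is dealt with separately.
  obtain ⟨k, hk⟩ : ∃ k, k = n + m := ⟨_, rfl⟩
  rw [← hk]
  by_cases hn : n < 0
  · rw [hf.eq_zero hn, zero_mul]; exact zero k
  by_cases hm : m < 0
  · rw [hg.eq_zero hm, mul_zero]; exact zero k
  induction k using weight_induction generalizing f g n m with
  | hneg k h0 => lia
  | hstep k h0 ih =>
    have aux : ∀ j : ℕ, ∀ {n m : ℤ} {f g : localFunctions Ω}, HasWeight n f → HasWeight m g →
        k - (j + 2) = n + m → HasWeight (k - (j + 2)) (f * g) := by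
      intro j n m f g hf hg h
      by_cases hn : n < 0
      · rw [hf.eq_zero hn, zero_mul]; exact zero _
      by_cases hm : m < 0
      · rw [hg.eq_zero hm, mul_zero]; exact zero _
      exact ih _ (by lia) hf hg h hn hm
    refine hasWeight_iff.2 ⟨fun h => by lia, fun j => ?_⟩
    rw [pd_mul]
    exact (aux j hf (hg.pd_u j) (by lia)).add (aux j hg (hf.pd_u j) (by lia))

lemma of_pd_u_eq_zero {f : localFunctions Ω} (h : ∀ j, pd (.u j) f = 0) : HasWeight 0 f :=
  hasWeight_iff.2 ⟨fun h => absurd h (lt_irrefl 0), fun j => by rw [h j]; exact zero _⟩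

lemma const (r : ℝ) : HasWeight 0 (algebraMap ℝ (localFunctions Ω) r) :=
  of_pd_u_eq_zero fun _ => pd_algebraMap _ r

lemma one : HasWeight 0 (1 : localFunctions Ω) := by
  simpa using const (Ω := Ω) 1

lemma smul {n : ℤ} {f : localFunctions Ω} (r : ℝ) (hf : HasWeight n f) : HasWeight n (r • f) := by
  rw [Algebra.smul_def]
  simpa using (const r).mul hf

lemma neg {n : ℤ} {f : localFunctions Ω} (hf : HasWeight n f) : HasWeight n (-f) := by
  simpa using hf.smul (-1)

lemma sub {n : ℤ} {f g : localFunctions Ω} (hf : HasWeight n f) (hg : HasWeight n g) :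
    HasWeight n (f - g) := by
  rw [sub_eq_add_neg]
  exact hf.add hg.neg

lemma sum {ι : Type*} {n : ℤ} (s : Finset ι) {f : ι → localFunctions Ω}
    (h : ∀ i ∈ s, HasWeight n (f i)) : HasWeight n (∑ i ∈ s, f i) :=
  Finset.sum_induction f (HasWeight n) (fun _ _ => add) (zero n) h

lemma coord_u (j : ℕ) : HasWeight (j + 2) (coord Ω (.u j)) := by
  refine hasWeight_iff.2 ⟨fun h => by lia, fun i => ?_⟩
  rw [pd_u_coord]
  split_ifs with h
  · rw [h, sub_self]; exact one
  · exact zero _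

/-- Derivatives along `x` and `t` preserve the weight. -/
lemma map_pd {n : ℤ} {f : localFunctions Ω} (v : JetVar) (hf : HasWeight n f) :
    HasWeight n (pd v f) := by
  induction n using weight_induction generalizing f with
  | hneg n hn => rw [hf.eq_zero hn, pd_zero]; exact zero n
  | hstep n hn ih =>
    refine hasWeight_iff.2 ⟨fun h => by lia, fun j => ?_⟩
    rw [pd_comm]
    exact ih _ (by lia) (hf.pd_u j)

lemma map_evolDer {n m : ℤ} {f : localFunctions Ω} {G : ℕ → localFunctions Ω}
    (hG : ∀ j : ℕ, HasWeight (m + (j + 2)) (G j)) (hf : HasWeight n f) :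
    HasWeight (n + m) (evolDer G f) := by
  obtain ⟨N, hN⟩ := exists_forall_pd_u_eq_zero f
  rw [evolDer_apply, finsum_mul_pd_eq G hN]
  exact sum _ fun j _ => ((hG j).mul (hf.pd_u j)).mono (by lia)

lemma map_Dx {n : ℤ} {f : localFunctions Ω} (hf : HasWeight n f) : HasWeight (n + 1) (Dx Ω f) := by
  rw [Dx_apply]
  exact ((hf.map_pd .x).mono (by lia)).add
    (hf.map_evolDer fun j => (coord_u (j + 1)).mono (by push_cast; lia))

lemma map_iterate_Dx {n : ℤ} {f : localFunctions Ω} (hf : HasWeight n f) (k : ℕ) :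
    HasWeight (n + k) ((Dx Ω)^[k] f) := by
  induction k with
  | zero => simpa using hf
  | succ k ih =>
    rw [Function.iterate_succ_apply']
    exact ih.map_Dx.mono (by push_cast; lia)

/-- `D_t` replaces `u_j`, of weight `j + 2`, by `D_x^j F`, of weight `m + j`. The bound `2 ≤ m` is
for `∂/∂t`, which leaves the weight unchanged. -/
lemma map_Dt {n m : ℤ} (hm : 2 ≤ m) {F f : localFunctions Ω} (hF : HasWeight m F)
    (hf : HasWeight n f) : HasWeight (n + (m - 2)) (Dt F f) := by
  rw [Dt_apply]
  exact ((hf.map_pd .t).mono (by lia)).add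
    (hf.map_evolDer fun j => (hF.map_iterate_Dx j).mono (by lia))

lemma Dt_sub_Dt {n m : ℤ} {F G f : localFunctions Ω} (hFG : HasWeight m (F - G))
    (hf : HasWeight n f) : HasWeight (n + (m - 2)) (Dt F f - Dt G f) := by
  have h : Dt F f - Dt G f = evolDer (fun j => (Dx Ω)^[j] (F - G)) f := by
    obtain ⟨N, hN⟩ := exists_forall_pd_u_eq_zero f
    rw [Dt_apply, Dt_apply, add_sub_add_left_eq_sub, evolDer_apply, evolDer_apply, evolDer_apply,
      finsum_mul_pd_eq _ hN, finsum_mul_pd_eq _ hN, finsum_mul_pd_eq _ hN,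
      ← Finset.sum_sub_distrib]
    exact Finset.sum_congr rfl fun j _ => by rw [iterate_map_sub, sub_mul]
  rw [h]
  exact hf.map_evolDer fun j => (hFG.map_iterate_Dx j).mono (by lia)

end HasWeight

/-! ### Weights of preimages under `D_x`, and an element outside its image -/

/-- Downward induction on `j`, from an order beyond which `f` does not depend on `u j`:
`pd_u_succ_Dx` is solved for `∂f/∂u_j`. -/
lemma hasWeight_pd_u_of_Dx {n : ℤ} {f : localFunctions Ω} (h : HasWeight n (Dx Ω f)) (j : ℕ) :
    HasWeight (n - (j + 3)) (pd (.u j) f) := by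
  obtain ⟨N, hN⟩ := exists_forall_pd_u_eq_zero f
  by_cases hj : N ≤ j
  · rw [hN j hj]; exact .zero _
  · refine Nat.decreasingInduction' (P := fun j => HasWeight (n - (j + 3)) (pd (.u j) f))
      (fun i _ _ ih => ?_) (le_of_not_ge hj) (by rw [hN N le_rfl]; exact .zero _)
    have h1 := pd_u_succ_Dx i f
    rw [← sub_eq_iff_eq_add'] at h1
    rw [← h1]
    exact ((h.pd_u (i + 1)).mono (by push_cast; lia)).sub (ih.map_Dx.mono (by push_cast; lia))

/-- If `D_x f` has weight at most `n ≥ 1`, then `f` has weight at most `n - 1`. -/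
lemma HasWeight.of_Dx {n : ℤ} {f : localFunctions Ω} (hn : 0 < n) (h : HasWeight n (Dx Ω f)) :
    HasWeight (n - 1) f :=
  -- Positivity of `n` is essential here: for `n = 0` the claim would be `f = 0`, which fails for
  -- constants.
  hasWeight_iff.2 ⟨fun h => by lia, fun j => (hasWeight_pd_u_of_Dx h j).mono (by lia)⟩

lemma hasWeight_zero_of_Dx_eq_zero {f : localFunctions Ω} (h : Dx Ω f = 0) : HasWeight 0 f :=
  (HasWeight.of_Dx one_pos (h ▸ HasWeight.zero 1)).mono (by lia)

/-- The function `u_1³` is not a total derivative modulo terms of lower weight. -/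
lemma eq_zero_of_Dx_sub_mul_coord_one_pow {c f : localFunctions Ω} (hc : HasWeight 0 c)
    (h : HasWeight 8 (Dx Ω f - c * coord Ω (.u 1) ^ 3)) : c = 0 := by
  set w := Dx Ω f - c * coord Ω (.u 1) ^ 3 with hw
  have hpc : ∀ j, pd (.u j) c = 0 := fun j => (hc.pd_u j).eq_zero (by lia)
  have hu : HasWeight 9 (c * coord Ω (.u 1) ^ 3) := by
    have h1 : HasWeight 3 (coord Ω (.u 1)) := HasWeight.coord_u 1
    have := hc.mul (h1.mul (h1.mul h1))
    rw [pow_three]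
    exact this
  have hf : HasWeight 8 f := by
    refine HasWeight.of_Dx (n := 9) (by lia) ?_
    rw [← sub_add_cancel (Dx Ω f) (c * coord Ω (.u 1) ^ 3)]
    exact (h.mono (by lia)).add hu
  have e : Dx Ω f = w + c * coord Ω (.u 1) ^ 3 := by rw [hw]; ring
  -- The index triples `111`, `012`, `003` all have total weight 9, so these third derivatives kill
  -- both `f` and `w`.
  have f111 : pd (.u 1) (pd (.u 1) (pd (.u 1) f)) = 0 := hf [1, 1, 1] (by simp)
  have f012 : pd (.u 0) (pd (.u 1) (pd (.u 2) f)) = 0 := hf [2, 1, 0] (by simp)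
  have f003 : pd (.u 0) (pd (.u 0) (pd (.u 3) f)) = 0 := hf [3, 0, 0] (by simp)
  have w111 : pd (.u 1) (pd (.u 1) (pd (.u 1) w)) = 0 := h [1, 1, 1] (by simp)
  have w012 : pd (.u 0) (pd (.u 1) (pd (.u 2) w)) = 0 := h [2, 1, 0] (by simp)
  have w003 : pd (.u 0) (pd (.u 0) (pd (.u 3) w)) = 0 := h [3, 0, 0] (by simp)
  have hpu : ∀ j, j ≠ 1 → pd (.u j) (c * coord Ω (.u 1) ^ 3) = 0 := fun j hj => by
    simp [pow_three, pd_mul, hpc, pd_u_coord, hj]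
  have e111 := congrArg (fun g => pd (.u 1) (pd (.u 1) (pd (.u 1) g))) e
  have e012 := congrArg (fun g => pd (.u 0) (pd (.u 1) (pd (.u 2) g))) e
  have e003 := congrArg (fun g => pd (.u 0) (pd (.u 0) (pd (.u 3) g))) e
  have s0 : ∀ g : localFunctions Ω,
      pd (.u 1) (Dx Ω g) = Dx Ω (pd (.u 1) g) + pd (.u 0) g := pd_u_succ_Dx 0
  have s1 : ∀ g : localFunctions Ω,
      pd (.u 2) (Dx Ω g) = Dx Ω (pd (.u 2) g) + pd (.u 1) g := pd_u_succ_Dx 1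
  have s2 : ∀ g : localFunctions Ω,
      pd (.u 3) (Dx Ω g) = Dx Ω (pd (.u 3) g) + pd (.u 2) g := pd_u_succ_Dx 2
  have p1 : pd (.u 1) (pd (.u 1) (pd (.u 1) (c * coord Ω (.u 1) ^ 3))) = (6 : ℝ) • c := by
    simp only [pow_three, pd_mul, pd_add, pd_coord_self, hpc, mul_zero, add_zero, mul_one]
    rw [show (1 : localFunctions Ω) = algebraMap ℝ _ 1 by simp, pd_algebraMap]
    apply Subtype.ext; funext p; simp; ring
  have s01 : ∀ g : localFunctions Ω, pd (.u 1) (pd (.u 0) g) = pd (.u 0) (pd (.u 1) g) :=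
    fun g => pd_comm _ _ g
  -- With subscripts for derivatives, commuting past `D_x` gives in turn `f₀₀₂ = 0`, then `f₀₀₂ +
  -- f₀₁₁ = 0`, then `3 f₀₁₁ = 6 c`.
  simp only [s2, pd_u_zero_Dx, pd_add, w003, f003, hpu 3 (by lia), pd_zero, map_zero,
    zero_add] at e003
  simp only [s0, s1, pd_u_zero_Dx, pd_add, w012, f012, hpu 2 (by lia), pd_zero, map_zero,
    zero_add, e003] at e012
  simp only [s0, pd_add, w111, f111, p1, map_zero, zero_add, s01, e012] at e111
  simpa using e111.symm

/-! ### Formal coefficients of the commutator -/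

/-- The binomial coefficient `x(x-1)⋯(x-k+1)/k!` of a real number. -/
noncomputable def realChoose (x : ℝ) (k : ℕ) : ℝ := (∏ i ∈ Finset.range k, (x - i)) / k.factorial

/-- Lets the degree `m` enter as a real parameter, so that the later identities are polynomial in
`m`. -/
lemma cast_ringChoose (z : ℤ) (k : ℕ) : ((Ring.choose z k : ℤ) : ℝ) = realChoose z k := by
  have h := congrArg (Int.cast : ℤ → ℝ) (Ring.descPochhammer_eq_factorial_smul_choose z k)
  rw [realChoose, eq_div_iff (by positivity), ← descPochhammer_eval_eq_prod_range]
  rw [← descPochhammer_eval_cast, Polynomial.eval_eq_smeval, h]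
  push_cast [nsmul_eq_mul]
  ring

lemma realChoose_zero (x : ℝ) : realChoose x 0 = 1 := by simp [realChoose]

section SymmetryDefect

variable {R : Type*} [CommRing R] [Algebra ℝ R]

/-- The `(j, k)` term of the coefficient of `D ^ (m + 4 - s)` in the commutator of
`∑ⱼ f_j D ^ j` with `∑ᵣ A_r D ^ (m - r)`. -/
noncomputable def commTerm (D : R → R) (f : ℕ → R) (m : ℝ) (A : ℤ → R) (s : ℤ) (j k : ℕ) : R :=
  (j.choose k : ℝ) • (f j * D^[k] (A (s - 4 + j - k))) -
    realChoose (m - (s - 4 + j - k : ℤ)) k • (A (s - 4 + j - k) * D^[k] (f j))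

/-- The coefficient of `D ^ (m + 4 - s)` in `T(L) - [f, L]`, where `L = ∑ᵣ A_r D ^ (m - r)` and
`f = ∑ⱼ f_j D ^ j` has order `5`. -/
noncomputable def symmetryDefect (D T : R → R) (f : ℕ → R) (m : ℝ) (A : ℤ → R) (s : ℤ) : R :=
  T (A (s - 4)) - ∑ j ∈ Finset.range 6, ∑ k ∈ Finset.range 10, commTerm D f m A s j k

lemma commTerm_zero_right (D : R → R) (f : ℕ → R) (m : ℝ) (A : ℤ → R) (s : ℤ) (j : ℕ) :
    commTerm D f m A s j 0 = 0 := by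
  simp [commTerm, realChoose_zero, mul_comm]

variable {D : Derivation ℝ R R} {f : ℕ → R} {m : ℝ} {A : ℤ → R} {s : ℤ}

lemma commTerm_eq_zero {j k : ℕ} (h : A (s - 4 + j - k) = 0) : commTerm D f m A s j k = 0 := by
  simp [commTerm, h]

lemma commTerm_five_one {κ : ℝ} (hf : f 5 = algebraMap ℝ R κ) :
    commTerm D f m A s 5 1 = (5 * κ) • D (A s) := by
  rw [commTerm, hf, show s - 4 + ((5 : ℕ) : ℤ) - ((1 : ℕ) : ℤ) = s by push_cast; ring]
  rw [Algebra.smul_def (5 * κ), map_mul, Algebra.smul_def]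
  simp [mul_assoc]

lemma iterate_derivation_const_mul {c : R} (hc : D c = 0) (a : R) (k : ℕ) :
    D^[k] (c * a) = c * D^[k] a := by
  induction k with
  | zero => rfl
  | succ k ih =>
    rw [Function.iterate_succ_apply', Function.iterate_succ_apply', ih, Derivation.leibniz, hc]
    simp

lemma commTerm_sub_five_one {κ : ℝ} {f g : ℕ → R} (hf : f 5 = algebraMap ℝ R κ)
    (hg : g 5 = algebraMap ℝ R κ) {c : R} (hc : D c = 0) (P : ℤ → R) :
    commTerm D f m A s 5 1 - c * commTerm D g m P s 5 1 = (5 * κ) • D (A s - c * P s) := by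
  rw [commTerm_five_one hf, commTerm_five_one hg, map_sub, Derivation.leibniz, hc, smul_sub,
    smul_zero, add_zero, smul_eq_mul, mul_smul_comm]

/-- Bilinearity: every term on the right carries a factor built from `A - c P` or from `f - g`,
which is where the weight drops. Since `D c = 0`, the factor `c` passes through `D^[k]`. -/
lemma commTerm_sub_const_mul {g : ℕ → R} {c : R} (hc : D c = 0) (P : ℤ → R) (j k : ℕ) :
    commTerm D f m A s j k - c * commTerm D g m P s j k =
      (j.choose k : ℝ) • (f j * D^[k] (A (s - 4 + j - k) - c * P (s - 4 + j - k)) +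
        (f j - g j) * (c * D^[k] (P (s - 4 + j - k)))) -
      realChoose (m - (s - 4 + j - k : ℤ)) k •
        ((A (s - 4 + j - k) - c * P (s - 4 + j - k)) * D^[k] (f j) +
          c * P (s - 4 + j - k) * D^[k] (f j - g j)) := by
  rw [commTerm, commTerm, iterate_map_sub, iterate_map_sub, iterate_derivation_const_mul hc]
  simp only [Algebra.smul_def]
  ring

/-- Isolates the `(5, 1)` term, the only one with `k > 0` that involves index `s`; all others with
`k > 0` have smaller index. -/
lemma symmetryDefect_eq_sub_sum_erase {T U : R → R} {g : ℕ → R} {κ : ℝ}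
    (hf : f 5 = algebraMap ℝ R κ) (hg : g 5 = algebraMap ℝ R κ) {c : R} (hc : D c = 0)
    (P : ℤ → R) :
    symmetryDefect D T f m A s - c * symmetryDefect D U g m P s +
        (5 * κ) • D (A s - c * P s) =
      (T (A (s - 4)) - c * U (P (s - 4))) -
        ∑ q ∈ (Finset.range 6 ×ˢ Finset.range 10).erase (5, 1),
          (commTerm D f m A s q.1 q.2 - c * commTerm D g m P s q.1 q.2) := by
  rw [Finset.sum_erase_eq_sub (by simp), commTerm_sub_five_one hf hg hc, Finset.sum_sub_distrib,
    ← Finset.mul_sum, Finset.sum_product, Finset.sum_product, symmetryDefect, symmetryDefect]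
  ring

end SymmetryDefect

/-! ### Coefficients of `D_t(L) - [F_*, L]` -/

lemma linearization_natCast (F : localFunctions Ω) (j : ℕ) :
    (linearization F).1 j = pd (.u j) F := by
  simp [linearization]

lemma linearization_eq_zero {F : localFunctions Ω} (hF : ∀ j ≥ 6, pd (.u j) F = 0) {i : ℤ}
    (hi : i < 0 ∨ 6 ≤ i) : (linearization F).1 i = 0 := by
  by_cases h : 0 ≤ i
  · obtain ⟨j, rfl⟩ := Int.eq_ofNat_of_zero_le h
    rw [linearization_natCast, hF j (by lia)]
  · simp [linearization, h]

lemma comp_linearization_left {F : localFunctions Ω} (hF : ∀ j ≥ 6, pd (.u j) F = 0)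
    (L : FormalSeries Ω) (n : ℤ) :
    (FormalSeries.comp (linearization F) L).1 n =
      ∑ j ∈ Finset.range 6, ∑ k ∈ Finset.range 10,
        (j.choose k : ℝ) • (pd (.u j) F * (Dx Ω)^[k] (L.1 (n - j + k))) := by
  let e : ℕ × ℕ ↪ ℤ × ℕ := ⟨fun q => (q.1, q.2), fun q r h => by
    simp only [Prod.mk.injEq, Nat.cast_inj] at h
    exact Prod.ext h.1 h.2⟩
  have h1 : (FormalSeries.comp (linearization F) L).1 n =
    ∑ q ∈ ((Finset.range 6) ×ˢ (Finset.range 10)).map e,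
      Ring.choose q.1 q.2 • ((linearization F).1 q.1 * totalDx^[q.2] (L.1 (n - q.1 + q.2))) := by
    apply finsum_eq_sum_of_support_subset
    rintro ⟨i, k⟩ hq
    have hi : 0 ≤ i ∧ i < 6 := by
      by_contra h
      exact hq (by simp [linearization_eq_zero hF (i := i) (by lia)])
    obtain ⟨j, rfl⟩ := Int.eq_ofNat_of_zero_le hi.1
    -- Already `k ≤ 5` would do; the larger range matches the one needed for the opposite product.
    have hk : k < 10 := by
      by_contra h
      refine hq ?_
      have : Ring.choose (j : ℤ) k = 0 := by
        rw [Ring.choose_natCast, Nat.choose_eq_zero_of_lt (by lia), Nat.cast_zero]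
      simp [this]
    simp only [Finset.coe_map, Set.mem_image, Finset.mem_coe, Finset.mem_product, Finset.mem_range]
    exact ⟨(j, k), ⟨by lia, hk⟩, rfl⟩
  rw [h1, Finset.sum_map, Finset.sum_product]
  refine Finset.sum_congr rfl fun j _ => Finset.sum_congr rfl fun k _ => ?_
  change Ring.choose (j : ℤ) k • ((linearization F).1 j * (Dx Ω)^[k] (L.1 (n - j + k))) = _
  rw [linearization_natCast, Ring.choose_natCast, Nat.cast_smul_eq_nsmul ℤ,
    Nat.cast_smul_eq_nsmul ℝ]

lemma comp_linearization_right {F : localFunctions Ω} (hF : ∀ j ≥ 6, pd (.u j) F = 0)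
    {L : FormalSeries Ω} {m n : ℤ} (hL : ∀ i > m, L.1 i = 0) (hn : m ≤ n + 4) :
    (FormalSeries.comp L (linearization F)).1 n =
      ∑ j ∈ Finset.range 6, ∑ k ∈ Finset.range 10,
        Ring.choose (n - j + k) k • (L.1 (n - j + k) * (Dx Ω)^[k] (pd (.u j) F)) := by
  let e : ℕ × ℕ ↪ ℤ × ℕ := ⟨fun q => (n - q.1 + q.2, q.2), fun q r h => by
    simp only [Prod.mk.injEq] at h
    exact Prod.ext (by lia) h.2⟩
  have h1 : (FormalSeries.comp L (linearization F)).1 n =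
    ∑ q ∈ ((Finset.range 6) ×ˢ (Finset.range 10)).map e,
      Ring.choose q.1 q.2 • (L.1 q.1 * totalDx^[q.2] ((linearization F).1 (n - q.1 + q.2))) := by
    apply finsum_eq_sum_of_support_subset
    rintro ⟨i, k⟩ hq
    have hi : i ≤ m := by
      by_contra h
      exact hq (by simp [hL i (by lia)])
    -- Here `j = n - i + k`. From `j ≤ 5` and `i ≤ m ≤ n + 4` follows `k ≤ 9`, whence the range of
    -- `k`.
    have hj : 0 ≤ n - i + k ∧ n - i + k < 6 := by
      by_contra h
      refine hq ?_
      simp [linearization_eq_zero hF (i := n - i + k) (by lia),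
        Function.iterate_fixed totalDx_zero]
    obtain ⟨j, hj'⟩ := Int.eq_ofNat_of_zero_le hj.1
    simp only [Finset.coe_map, Set.mem_image, Finset.mem_coe, Finset.mem_product, Finset.mem_range]
    refine ⟨(j, k), ⟨by lia, by lia⟩, ?_⟩
    change (n - j + k, k) = (i, k)
    rw [Prod.mk.injEq]
    exact ⟨by lia, rfl⟩
  rw [h1, Finset.sum_map, Finset.sum_product]
  refine Finset.sum_congr rfl fun j _ => Finset.sum_congr rfl fun k _ => ?_
  change Ring.choose (n - j + k : ℤ) k •
    (L.1 (n - j + k) * (Dx Ω)^[k] ((linearization F).1 (n - (n - j + k) + k))) = _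
  rw [show n - (n - j + k) + k = (j : ℤ) by lia, linearization_natCast]

lemma coeff_dt_sub_commutator {F : localFunctions Ω} (hF : ∀ j ≥ 6, pd (.u j) F = 0)
    {L : FormalSeries Ω} {m s : ℤ} (hL : ∀ i > m, L.1 i = 0) (hs : s ≤ 8) :
    (FormalSeries.dt F L - FormalSeries.commutator (linearization F) L).1 (m + 4 - s) =
      symmetryDefect (Dx Ω) (Dt F) (fun j => pd (.u j) F) m (fun r => L.1 (m - r)) s := by
  change totalDt F (L.1 (m + 4 - s)) - ((FormalSeries.comp (linearization F) L).1 (m + 4 - s) -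
    (FormalSeries.comp L (linearization F)).1 (m + 4 - s)) = _
  rw [comp_linearization_left hF, comp_linearization_right hF hL (by lia), symmetryDefect,
    ← Finset.sum_sub_distrib, totalDt_eq]
  congr 2
  · lia
  · funext j
    rw [← Finset.sum_sub_distrib]
    refine Finset.sum_congr rfl fun k _ => ?_
    have h : m + 4 - s - j + k = m - (s - 4 + j - k) := by lia
    rw [commTerm, h, ← Int.cast_sub, ← cast_ringChoose, Int.cast_smul_eq_zsmul]

/-! ### Comparison with the top weight part -/

lemma HasWeight.pd_u_sub {F Φ : localFunctions Ω} {n : ℤ} (h : HasWeight n (F - Φ)) (j : ℕ) :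
    HasWeight (n - (j + 2)) (KRRI.pd (.u j) F - KRRI.pd (.u j) Φ) := by
  rw [← pdDer_apply, ← pdDer_apply, ← map_sub]
  exact h.pd_u j

/-- The coefficient of `D ^ (m + 4 - s)` in `D_t(L) - [F_*, L]`, where
`L = ∑ᵣ A_r D ^ (m - r)`. -/
noncomputable def jetDefect (F : localFunctions Ω) (m : ℝ) (A : ℤ → localFunctions Ω) (s : ℤ) :
    localFunctions Ω :=
  symmetryDefect (Dx Ω) (Dt F) (fun j => pd (.u j) F) m A s

section Comparison

variable {m κ : ℝ} {F Φ c : localFunctions Ω} {A P : ℤ → localFunctions Ω} {s : ℤ}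

/-- A single term has weight `(5 - j) + (s - 4 + j - k) + k = s + 1`; replacing `A` by `c P` or `F`
by `Φ` costs only terms of weight one less. -/
lemma hasWeight_commTerm_sub (hF : HasWeight 7 F) (hFΦ : HasWeight 6 (F - Φ)) (hc : Dx Ω c = 0)
    {j k : ℕ} (hP : HasWeight (s - 4 + j - k) (P (s - 4 + j - k)))
    (hA : HasWeight (s - 4 + j - k - 1) (A (s - 4 + j - k) - c * P (s - 4 + j - k))) :
    HasWeight s (commTerm (Dx Ω) (fun j => pd (.u j) F) m A s j k -
      c * commTerm (Dx Ω) (fun j => pd (.u j) Φ) m P s j k) := by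
  have hc0 := hasWeight_zero_of_Dx_eq_zero hc
  have hf := hF.pd_u j
  have hff := hFΦ.pd_u_sub j
  rw [commTerm_sub_const_mul hc]
  have h1 := hf.mul (hA.map_iterate_Dx k)
  have h2 := hff.mul (hc0.mul (hP.map_iterate_Dx k))
  have h3 := hA.mul (hf.map_iterate_Dx k)
  have h4 := (hc0.mul hP).mul (hff.map_iterate_Dx k)
  exact (HasWeight.smul _ ((h1.mono (by lia)).add (h2.mono (by lia)))).sub
    (HasWeight.smul _ ((h3.mono (by lia)).add (h4.mono (by lia))))

lemma hasWeight_Dt_sub (hF : HasWeight 7 F) (hFΦ : HasWeight 6 (F - Φ)) (hc : Dx Ω c = 0)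
    (hP : HasWeight (s - 4) (P (s - 4)))
    (hA : HasWeight (s - 4 - 1) (A (s - 4) - c * P (s - 4))) :
    HasWeight s (Dt F (A (s - 4)) - c * Dt Φ (P (s - 4))) := by
  have hc0 := hasWeight_zero_of_Dx_eq_zero hc
  have e1 : Dt F c = pd .t c := by
    rw [Dt_apply, evolDer_apply, add_eq_left]
    exact finsum_eq_zero_of_forall_eq_zero fun j => by
      rw [(hc0.pd_u j).eq_zero (by lia), mul_zero]
  -- `c` may depend on `t`, but `∂c/∂t` has weight 0, so its contribution is harmless.
  have e : Dt F (A (s - 4)) - c * Dt Φ (P (s - 4)) =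
      Dt F (A (s - 4) - c * P (s - 4)) + pd .t c * P (s - 4) +
        c * (Dt F (P (s - 4)) - Dt Φ (P (s - 4))) := by
    rw [map_sub, Derivation.leibniz, e1, smul_eq_mul, smul_eq_mul]
    ring
  rw [e]
  have h1 := HasWeight.map_Dt (by lia) hF hA
  have h2 := (hc0.map_pd .t).mul hP
  have h3 := hc0.mul (hFΦ.Dt_sub_Dt hP)
  exact ((h1.mono (by lia)).add (h2.mono (by lia))).add (h3.mono (by lia))

lemma pd_u_five_eq (hFΦ : HasWeight 6 (F - Φ)) (hκ : pd (.u 5) Φ = algebraMap ℝ _ κ) :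
    pd (.u 5) F = algebraMap ℝ _ κ := by
  rw [← sub_eq_zero, ← hκ]
  exact (hFΦ.pd_u_sub 5).eq_zero (by lia)

lemma jetDefect_sub (hF : HasWeight 7 F) (hFΦ : HasWeight 6 (F - Φ))
    (hκ : pd (.u 5) Φ = algebraMap ℝ _ κ) (hc : Dx Ω c = 0) (hP : ∀ r, HasWeight r (P r))
    (hA : ∀ r < s, HasWeight (r - 1) (A r - c * P r)) :
    HasWeight s (jetDefect F m A s - c * jetDefect Φ m P s + (5 * κ) • Dx Ω (A s - c * P s)) := by
  rw [jetDefect, jetDefect, symmetryDefect_eq_sub_sum_erase (pd_u_five_eq hFΦ hκ) hκ hc]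
  refine (hasWeight_Dt_sub hF hFΦ hc (hP _) (hA _ (by lia))).sub (.sum _ fun q hq => ?_)
  obtain ⟨j, k⟩ := q
  simp only [Finset.mem_erase, Finset.mem_product, Finset.mem_range, ne_eq,
    Prod.mk.injEq] at hq
  dsimp only
  rcases Nat.eq_zero_or_pos k with rfl | hk
  · rw [commTerm_zero_right, commTerm_zero_right, mul_zero, sub_zero]
    exact .zero s
  · exact hasWeight_commTerm_sub hF hFΦ hc (hP _) (hA _ (by lia))

lemma jetDefect_zero (hκ : pd (.u 5) F = algebraMap ℝ _ κ) (hA : ∀ r < 0, A r = 0) :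
    jetDefect F m A 0 = -((5 * κ) • Dx Ω (A 0)) := by
  rw [jetDefect, symmetryDefect, hA _ (by lia), map_zero, zero_sub, Finset.sum_eq_single 5,
    Finset.sum_eq_single 1]
  · rw [commTerm_five_one hκ]
  · intro k _ hk
    rcases Nat.eq_zero_or_pos k with rfl | hk'
    · exact commTerm_zero_right _ _ _ _ _ _
    · exact commTerm_eq_zero (hA _ (by push_cast; lia))
  · simp
  · intro j hj hj5
    refine Finset.sum_eq_zero fun k _ => ?_
    rcases Nat.eq_zero_or_pos k with rfl | hk'
    · exact commTerm_zero_right _ _ _ _ _ _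
    · have := Finset.mem_range.1 hj
      exact commTerm_eq_zero (hA _ (by lia))
  · simp

/-- An evolution equation with constant separant whose top weight part `Φ` has weight `7` has no
formal symmetry `∑ᵣ A_r D ^ (m - r)` as soon as an approximate symmetry `P` of the top weight part
is obstructed by a multiple of `u_1³`. -/
lemma eq_zero_of_jetDefect {γ : ℝ} (hF : HasWeight 7 F) (hFΦ : HasWeight 6 (F - Φ))
    (hκ : pd (.u 5) Φ = algebraMap ℝ _ κ) (hκ0 : κ ≠ 0) (hγ : γ ≠ 0)
    (hP : ∀ r, HasWeight r (P r)) (hP0 : P 0 = 1)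
    (hPs : ∀ s, 0 < s → s < 8 → jetDefect Φ m P s = 0)
    (hP8 : jetDefect Φ m P 8 = γ • coord Ω (.u 1) ^ 3)
    (hAneg : ∀ r < 0, A r = 0) (hAs : ∀ s, 0 ≤ s → s ≤ 8 → jetDefect F m A s = 0) :
    A 0 = 0 := by
  have h5κ : 5 * κ ≠ 0 := mul_ne_zero (by norm_num) hκ0
  have hA0 : Dx Ω (A 0) = 0 := by
    have h1 := jetDefect_zero (m := m) (pd_u_five_eq hFΦ hκ) hAneg
    rw [hAs 0 le_rfl (by lia), eq_comm, neg_eq_zero, smul_eq_zero] at h1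
    exact h1.resolve_left h5κ
  -- Equation `s` bounds the weight of `D_x(A_s - c P_s)` by `s`, and integrating lowers the bound
  -- by one.
  have key : ∀ N : ℕ, N ≤ 8 → ∀ r < (N : ℤ), HasWeight (r - 1) (A r - A 0 * P r) := by
    intro N hN
    induction N with
    | zero =>
      intro r hr
      rw [hAneg r (by simpa using hr), (hP r).eq_zero (by simpa using hr), mul_zero, sub_zero]
      exact .zero _
    | succ N ih =>
      intro r hr
      by_cases hrN : r < N
      · exact ih (by lia) r hrN
      obtain rfl : r = N := by push_cast at hr; lia
      -- At index 0 the bound `-1` demands exact equality, supplied by `P 0 = 1`; integration needs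
      -- a positive index.
      rcases Nat.eq_zero_or_pos N with rfl | hpos
      · rw [Nat.cast_zero, hP0, mul_one, sub_self]
        exact .zero _
      refine .of_Dx (by lia) ?_
      have h1 := jetDefect_sub (m := m) (s := N) hF hFΦ hκ hA0 hP (ih (by lia))
      rw [hAs N (by lia) (by lia), hPs N (by lia) (by lia), mul_zero, sub_zero, zero_add] at h1
      have h2 := h1.smul (5 * κ)⁻¹
      rwa [inv_smul_smul₀ h5κ] at h2
  have h8 := jetDefect_sub (m := m) (s := 8) hF hFΦ hκ hA0 hP (key 8 le_rfl)
  rw [hAs 8 (by lia) le_rfl, hP8, zero_sub] at h8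
  have h9 := h8.smul (γ⁻¹)
  -- Nothing is known about `A 8` beyond its appearance under `D_x`; that suffices, as the lemma
  -- allows any primitive.
  refine eq_zero_of_Dx_sub_mul_coord_one_pow (f := γ⁻¹ • (5 * κ) • (A 8 - A 0 * P 8))
    (hasWeight_zero_of_Dx_eq_zero hA0) ?_
  convert h9 using 1
  rw [Derivation.map_smul, Derivation.map_smul, smul_add, smul_neg,
    Algebra.mul_smul_comm γ, inv_smul_smul₀ hγ]
  ring

end Comparison

/-! ### The explicit computation for the top weight part -/

section TopWeight

variable {R : Type*} [CommRing R] [Algebra ℝ R]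

/-- The right-hand side of the top weight part `v_t = β(-19/360 v_5 - …)` of the KRRI equation,
where `v = (a / b) u` and `β = b ^ 2`. -/
noncomputable def topFlow (v : ℕ → R) (β : ℝ) : R :=
  β • ((-19 / 360 : ℝ) • v 5 - (23 / 24 : ℝ) • (v 1 * v 2) - (5 / 12 : ℝ) • (v 0 * v 3) +
    (3 / 8 : ℝ) • (v 0 * v 0 * v 1))

/-- The coefficients of the linearization of `topFlow`. -/
noncomputable def topCoeff (v : ℕ → R) (β : ℝ) : ℕ → R
  | 0 => β • ((-5 / 12 : ℝ) • v 3 + (3 / 4 : ℝ) • (v 0 * v 1))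
  | 1 => β • ((-23 / 24 : ℝ) • v 2 + (3 / 8 : ℝ) • (v 0 * v 0))
  | 2 => β • ((-23 / 24 : ℝ) • v 1)
  | 3 => β • ((-5 / 12 : ℝ) • v 0)
  | 5 => algebraMap ℝ R (-19 / 360 * β)
  | _ => 0

/-- The coefficients of a formal symmetry of degree `m` and of the largest possible rank of the top
weight part of the KRRI equation: the coefficient of `D ^ (m - r)` is `approxSymmetry v m r`. -/
noncomputable def approxSymmetry (v : ℕ → R) (m : ℝ) (r : ℤ) : R :=
  if r = 0 then 1
  else if r = 2 then
    (30/19 * m) • v 0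
  else if r = 3 then
    (-6/19 * m + 15/19 * m ^ 2) • v 1
  else if r = 4 then
    (-7/38 * m - 21/38 * m ^ 2 + 5/19 * m ^ 3) • v 2 +
      (-2763/361 * m + 450/361 * m ^ 2) • (v 0 * v 0)
  else if r = 5 then
    (1/4 * m ^ 2 - 6/19 * m ^ 3 + 5/76 * m ^ 4) • v 3 +
      (6939/361 * m - 3843/361 * m ^ 2 + 450/361 * m ^ 3) • (v 0 * v 1)
  else if r = 6 then
    (39/76 * m - 31/152 * m ^ 2 + 5/19 * m ^ 3 - 17/152 * m ^ 4 + 1/76 * m ^ 5) • v 4 +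
      (-3330/361 * m + 6276/361 * m ^ 2 - 1836/361 * m ^ 3 + 150/361 * m ^ 4) • (v 0 * v 2) +
      (-5295/722 * m + 5139/361 * m ^ 2 - 1461/361 * m ^ 3 + 225/722 * m ^ 4) • (v 1 * v 1) +
      (296820/6859 * m - 82890/6859 * m ^ 2 + 4500/6859 * m ^ 3) • (v 0 * v 0 * v 0)
  else if r = 7 then
    (-289/380 * m + 193/456 * m ^ 2 - 9/38 * m ^ 3 + 29/228 * m ^ 4 - 11/380 * m ^ 5 +
      1/456 * m ^ 6) • v 5 +
      (-1665/722 * m - 25143/1444 * m ^ 2 + 3540/361 * m ^ 3 - 2541/1444 * m ^ 4 +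
        75/722 * m ^ 5) • (v 0 * v 3) +
      (-16293/722 * m - 50571/1444 * m ^ 2 + 7833/361 * m ^ 3 - 5463/1444 * m ^ 4 +
        75/361 * m ^ 5) • (v 1 * v 2) +
      (-2005182/6859 * m + 1001538/6859 * m ^ 2 - 154035/6859 * m ^ 3 + 6750/6859 * m ^ 4) •
        (v 0 * v 0 * v 1)
  else if r = 8 then
    (297/665 * m - 493/760 * m ^ 2 + 275/912 * m ^ 3 - 41/304 * m ^ 4 + 187/4560 * m ^ 5 -
      9/1520 * m ^ 6 + 1/3192 * m ^ 7) • v 6 +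
      (-351/1805 * m + 10017/722 * m ^ 2 - 4692/361 * m ^ 3 + 1392/361 * m ^ 4 -
        849/1805 * m ^ 5 + 15/722 * m ^ 6) • (v 0 * v 4) +
      (188817/3610 * m + 27459/1444 * m ^ 2 - 12375/361 * m ^ 3 + 3849/361 * m ^ 4 -
        2271/1805 * m ^ 5 + 75/1444 * m ^ 6) • (v 1 * v 3) +
      (323103/7220 * m + 24511/2888 * m ^ 2 - 8397/361 * m ^ 3 + 21289/2888 * m ^ 4 -
        327/380 * m ^ 5 + 25/722 * m ^ 6) • (v 2 * v 2) +
      (2449332/6859 * m - 4439763/13718 * m ^ 2 + 1212633/13718 * m ^ 3 - 64170/6859 * m ^ 4 +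
        2250/6859 * m ^ 5) • (v 0 * v 0 * v 2) +
      (4368492/6859 * m - 3598470/6859 * m ^ 2 + 953613/6859 * m ^ 3 - 98775/6859 * m ^ 4 +
        3375/6859 * m ^ 5) • (v 0 * v 1 * v 1) +
      (-36227088/130321 * m + 25443369/260642 * m ^ 2 - 1243350/130321 * m ^ 3 +
        33750/130321 * m ^ 4) • (v 0 * v 0 * v 0 * v 0)
  else 0

set_option maxHeartbeats 4000000 in
-- Equation `s` determines `D P_s` from the earlier `P_r`; the coefficients of `approxSymmetry` are
-- its homogeneous solutions. In an abstract algebra with `D v_j = v_{j+1}`, each case is a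
-- polynomial identity in the `v_j` and in `m`, `β`.
lemma symmetryDefect_top (v : ℕ → R) (m β : ℝ) {D T : Derivation ℝ R R}
    (hD : ∀ j, D (v j) = v (j + 1)) (hT : ∀ j, T (v j) = D^[j] (topFlow v β)) {s : ℤ}
    (h0 : 0 < s) (h8 : s < 8) :
    symmetryDefect D T (topCoeff v β) m (approxSymmetry v m) s = 0 := by
  interval_cases s <;>
  · simp [symmetryDefect, Finset.sum_range_succ, commTerm, topCoeff, approxSymmetry, hD, hT,
      realChoose, Finset.prod_range_succ, Nat.choose, Nat.factorial, topFlow]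
    try algebra

set_option maxHeartbeats 4000000 in
-- `P_8` absorbs everything but a multiple of `v₁³`. The factor `m` is to be expected: for `m = 0`
-- the series `P` is the identity, a trivial symmetry.
lemma symmetryDefect_top_eight (v : ℕ → R) (m β : ℝ) {D T : Derivation ℝ R R}
    (hD : ∀ j, D (v j) = v (j + 1)) (hT : ∀ j, T (v j) = D^[j] (topFlow v β)) :
    symmetryDefect D T (topCoeff v β) m (approxSymmetry v m) 8 =
      (-1413 / 2888 * m * β) • v 1 ^ 3 := by
  simp [symmetryDefect, Finset.sum_range_succ, commTerm, topCoeff, approxSymmetry, hD, hT,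
    realChoose, Finset.prod_range_succ, Nat.choose, Nat.factorial, topFlow]
  algebra

end TopWeight

/-! ### Transfer to the KRRI equation -/

/-- Applied with `v = ν u` and `δ = ∂/∂u_j`; the chain rule factor `ν` cancels the `ν⁻¹` in `Φ = ν⁻¹
• topFlow`. -/
lemma derivation_topFlow {R : Type*} [CommRing R] [Algebra ℝ R] (v : ℕ → R) (β : ℝ) {ν : ℝ}
    {δ : Derivation ℝ R R} {j : ℕ} (hδ : ∀ i, δ (v i) = if j = i then algebraMap ℝ R ν else 0) :
    δ (topFlow v β) = ν • topCoeff v β j := by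
  simp only [topFlow, Derivation.map_smul, map_add, map_sub, Derivation.leibniz, hδ]
  rcases j with _ | _ | _ | _ | _ | _ | j <;> simp [topCoeff]
  all_goals algebra

lemma smul_smul_pow {R : Type*} [CommRing R] [Algebra ℝ R] (r ν : ℝ) (x : R) (n : ℕ) :
    r • (ν • x) ^ n = (r * ν ^ n) • x ^ n := by
  rw [smul_pow, smul_smul]

variable (Ω) in
/-- The rescaled jet variable `ν u_j`. -/
noncomputable def scaledU (ν : ℝ) (j : ℕ) : localFunctions Ω := ν • coord Ω (.u j)

lemma pd_u_scaledU (ν : ℝ) (i j : ℕ) :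
    pd (.u i) (scaledU Ω ν j) = if i = j then algebraMap ℝ _ ν else 0 := by
  rw [scaledU, pd_smul, pd_u_coord]
  split_ifs
  · rw [Algebra.algebraMap_eq_smul_one]
  · rw [smul_zero]

lemma Dx_scaledU (ν : ℝ) (j : ℕ) : Dx Ω (scaledU Ω ν j) = scaledU Ω ν (j + 1) := by
  rw [scaledU, Derivation.map_smul, Dx_coord, scaledU]

lemma hasWeight_scaledU (ν : ℝ) (j : ℕ) : HasWeight (j + 2) (scaledU Ω ν j) :=
  (HasWeight.coord_u j).smul ν

lemma iterate_Dx_smul (r : ℝ) (f : localFunctions Ω) (j : ℕ) :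
    (Dx Ω)^[j] (r • f) = r • (Dx Ω)^[j] f := by
  induction j with
  | zero => rfl
  | succ j ih =>
    rw [Function.iterate_succ_apply', Function.iterate_succ_apply', ih, Derivation.map_smul]

lemma Dt_topFlow_scaledU (β : ℝ) {ν : ℝ} (hν : ν ≠ 0) (j : ℕ) :
    Dt (ν⁻¹ • topFlow (scaledU Ω ν) β) (scaledU Ω ν j) =
      (Dx Ω)^[j] (topFlow (scaledU Ω ν) β) := by
  rw [scaledU, Derivation.map_smul, Dt_coord, iterate_Dx_smul, smul_inv_smul₀ hν]

lemma pd_u_topFlow (β : ℝ) {ν : ℝ} (hν : ν ≠ 0) :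
    (fun j => pd (.u j) (ν⁻¹ • topFlow (scaledU Ω ν) β)) = topCoeff (scaledU Ω ν) β := by
  funext j
  rw [pd_smul, ← pdDer_apply, derivation_topFlow _ β (fun i => pd_u_scaledU ν j i),
    inv_smul_smul₀ hν]

lemma jetDefect_topFlow (m β : ℝ) {ν : ℝ} (hν : ν ≠ 0) {s : ℤ} (h0 : 0 < s) (h8 : s < 8) :
    jetDefect (ν⁻¹ • topFlow (scaledU Ω ν) β) m (approxSymmetry (scaledU Ω ν) m) s = 0 := by
  rw [jetDefect, pd_u_topFlow β hν]
  have hT := Dt_topFlow_scaledU (Ω := Ω) β hν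
  generalize Dt (ν⁻¹ • topFlow (scaledU Ω ν) β) = T at hT ⊢
  exact symmetryDefect_top (D := Dx Ω) (T := T) _ m β (Dx_scaledU ν) hT h0 h8

lemma jetDefect_topFlow_eight (m β : ℝ) {ν : ℝ} (hν : ν ≠ 0) :
    jetDefect (ν⁻¹ • topFlow (scaledU Ω ν) β) m (approxSymmetry (scaledU Ω ν) m) 8 =
      (-1413 / 2888 * m * β * ν ^ 3) • coord Ω (.u 1) ^ 3 := by
  rw [jetDefect, pd_u_topFlow β hν]
  have hT := Dt_topFlow_scaledU (Ω := Ω) β hν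
  generalize Dt (ν⁻¹ • topFlow (scaledU Ω ν) β) = T at hT ⊢
  rw [symmetryDefect_top_eight (D := Dx Ω) (T := T) _ m β (Dx_scaledU ν) hT, scaledU,
    smul_smul_pow]

lemma hasWeight_topFlow (ν β : ℝ) : HasWeight 7 (topFlow (scaledU Ω ν) β) := by
  have h := hasWeight_scaledU (Ω := Ω) ν
  exact (((((h 5).smul _).sub (((h 1).mul (h 2)).smul _)).sub (((h 0).mul (h 3)).smul _)).add
    ((((h 0).mul (h 0)).mul (h 1)).smul _)).smul _

lemma hasWeight_approxSymmetry (m ν : ℝ) (r : ℤ) :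
    HasWeight r (approxSymmetry (scaledU Ω ν) m r) := by
  have h := hasWeight_scaledU (Ω := Ω) ν
  have h2 := fun i j => (h i).mul (h j)
  have h3 := fun i j k => (h2 i j).mul (h k)
  have h4 := fun i j k l => (h3 i j k).mul (h l)
  unfold approxSymmetry
  split_ifs <;> (try subst r)
  · exact .one
  · exact (h 0).smul _
  · exact (h 1).smul _
  · exact ((h 2).smul _).add ((h2 0 0).smul _)
  · exact ((h 3).smul _).add ((h2 0 1).smul _)
  · exact ((((h 4).smul _).add ((h2 0 2).smul _)).add ((h2 1 1).smul _)).add ((h3 0 0 0).smul _)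
  · exact ((((h 5).smul _).add ((h2 0 3).smul _)).add ((h2 1 2).smul _)).add ((h3 0 0 1).smul _)
  · exact ((((((h 6).smul _).add ((h2 0 4).smul _)).add ((h2 1 3).smul _)).add
      ((h2 2 2).smul _)).add ((h3 0 0 2).smul _)).add ((h3 0 1 1).smul _) |>.add
      ((h4 0 0 0 0).smul _)
  · exact .zero _

lemma hasWeight_ofX (h : ℝ → ℝ) (hh : ∀ p ∈ Ω, ContDiffAt ℝ ∞ h (p JetVar.x)) :
    HasWeight 0 (ofX h hh) :=
  .of_pd_u_eq_zero fun j => by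
    apply Subtype.ext
    funext p
    exact partialDeriv_of_notMem (S := {JetVar.x})
      (g := fun q => h (q ⟨JetVar.x, Finset.mem_singleton_self _⟩)) (by simp) (fun _ => rfl) p

lemma HasWeight.iterate_pd {n : ℤ} {f : localFunctions Ω} (v : JetVar) (hf : HasWeight n f)
    (k : ℕ) : HasWeight n ((KRRI.pd v)^[k] f) := by
  induction k with
  | zero => exact hf
  | succ k ih => rw [Function.iterate_succ_apply']; exact ih.map_pd v

/-- With `ν = a / b` and `β = b²`, the linear, quadratic and cubic terms of `Φ` acquire `b²`, `b² ν
= a b` and `b² ν² = a²`, exactly as in `F`. What is left involves lower weight only. -/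
lemma hasWeight_krriRHS_sub (a d : ℝ) {b : ℝ} (ha : a ≠ 0) (hb : b ≠ 0) (h : ℝ → ℝ)
    (hh : ∀ p ∈ Ω, ContDiffAt ℝ ∞ h (p JetVar.x)) :
    HasWeight 6 (krriRHS a b d h hh - (a / b)⁻¹ • topFlow (scaledU Ω (a / b)) (b ^ 2)) := by
  have hu := fun j : ℕ => HasWeight.coord_u (Ω := Ω) j
  have hH := fun j : ℕ => (hasWeight_ofX h hh).iterate_pd .x j
  have hHu := fun i j : ℕ => (hH i).mul (hu j)
  have e : krriRHS a b d h hh - (a / b)⁻¹ • topFlow (scaledU Ω (a / b)) (b ^ 2) =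
      -coord Ω (.u 1) - (3 / 2 * a) • (coord Ω (.u 0) * coord Ω (.u 1)) -
        (1 / 6 * b) • coord Ω (.u 3) +
      (d / 2) • ((pd .x)^[1] (ofX h hh) * coord Ω (.u 0) +
        (pd .x)^[0] (ofX h hh) * coord Ω (.u 1)) +
      (1 / 4 * b * d) • (-((pd .x)^[3] (ofX h hh) * coord Ω (.u 0)) -
        (pd .x)^[2] (ofX h hh) * coord Ω (.u 1) + (pd .x)^[1] (ofX h hh) * coord Ω (.u 2) +
        (pd .x)^[0] (ofX h hh) * coord Ω (.u 3)) := by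
    simp only [krriRHS, topFlow, scaledU]
    generalize (pd .x)^[1] (ofX h hh) = H1
    generalize (pd .x)^[2] (ofX h hh) = H2
    generalize (pd .x)^[3] (ofX h hh) = H3
    generalize (pd .x)^[0] (ofX h hh) = H0
    apply Subtype.ext
    funext p
    simp
    field_simp
    ring
  rw [e]
  refine HasWeight.add (.add (.sub (.sub (.neg ?_) (.smul _ ?_)) (.smul _ ?_))
    (.smul _ (.add ?_ ?_))) (.smul _ (.add (.add (.sub (.neg ?_) ?_) ?_) ?_))
  · exact (hu 1).mono (by norm_num)
  · exact ((hu 0).mul (hu 1)).mono (by norm_num)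
  · exact (hu 3).mono (by norm_num)
  · exact (hHu 1 0).mono (by norm_num)
  · exact (hHu 0 1).mono (by norm_num)
  · exact (hHu 3 0).mono (by norm_num)
  · exact (hHu 2 1).mono (by norm_num)
  · exact (hHu 1 2).mono (by norm_num)
  · exact (hHu 0 3).mono (by norm_num)

/-! ### Degrees of formal series -/

namespace FormalSeries

lemma coeff_eq_zero_of_deg_lt {L : FormalSeries Ω} {i : ℤ} (h : deg L < i) : L.1 i = 0 := by
  by_contra hi
  have hL : L ≠ 0 := by
    rintro rfl
    exact hi rfl
  rw [deg, if_neg hL, WithBot.coe_lt_coe] at h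
  obtain ⟨N, hN⟩ := L.2
  refine absurd (le_csSup ⟨N, fun j hj => ?_⟩ (show i ∈ {i : ℤ | L.1 i ≠ 0} from hi)) h.not_ge
  by_contra hlt
  exact hj (hN j (not_le.1 hlt))

lemma exists_deg_eq {L : FormalSeries Ω} (h : L ≠ 0) :
    ∃ m : ℤ, deg L = m ∧ L.1 m ≠ 0 := by
  refine ⟨_, if_neg h, ?_⟩
  obtain ⟨N, hN⟩ := L.2
  refine Int.csSup_mem (s := {i : ℤ | L.1 i ≠ 0}) ?_ ⟨N, fun j hj => ?_⟩
  · by_contra hne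
    rw [Set.not_nonempty_iff_eq_empty] at hne
    refine h (Subtype.ext (funext fun i => ?_))
    by_contra hi
    exact (hne ▸ (show i ∈ {i : ℤ | L.1 i ≠ 0} from hi) : i ∈ (∅ : Set ℤ))
  · by_contra hlt
    exact hj (hN j (not_le.1 hlt))

lemma deg_le {L : FormalSeries Ω} {n : ℤ} (h : ∀ i > n, L.1 i = 0) : deg L ≤ n := by
  by_cases hL : L = 0
  · simp [deg, hL]
  obtain ⟨m, hm, hm0⟩ := exists_deg_eq hL
  rw [hm, WithBot.coe_le_coe]
  by_contra hlt
  exact hm0 (h m (not_le.1 hlt))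

end FormalSeries

end KRRI

theorem theorem2 (a b d : ℝ) (ha : a ≠ 0) (hb : b ≠ 0) (hd : d ≠ 0)
    (Ω : TopologicalSpace.Opens KRRI.Jet) (h : ℝ → ℝ)
    (hh : ∀ p ∈ Ω, ContDiffAt ℝ (⊤ : ℕ∞) h (p KRRI.JetVar.x)) (k : ℤ) (hk : 9 < k) :
    ¬ ∃ L : KRRI.FormalSeries Ω,
      KRRI.IsFormalRecursionOperator (KRRI.krriRHS a b d h hh) k L := by
  open KRRI in
  rintro ⟨L, hL0, hdeg, hL⟩
  obtain ⟨m, hm, hm0⟩ := FormalSeries.exists_deg_eq hL0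
  have hm_ne : m ≠ 0 := by
    rintro rfl
    exact hdeg (by rw [hm]; rfl)
  have hν : a / b ≠ 0 := div_ne_zero ha hb
  have hFΦ := hasWeight_krriRHS_sub a d ha hb h hh
  set F := krriRHS a b d h hh
  set Φ := (a / b)⁻¹ • topFlow (scaledU Ω (a / b)) (b ^ 2) with hΦ
  have hF : HasWeight 7 F := by
    rw [← sub_add_cancel F Φ]
    exact (hFΦ.mono (by lia)).add ((hasWeight_topFlow _ _).smul _)
  have hF6 : ∀ j ≥ 6, pd (.u j) F = 0 := fun j hj => (hF.pd_u j).eq_zero (by lia)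
  have hLm : ∀ i > m, L.1 i = 0 := fun i hi =>
    FormalSeries.coeff_eq_zero_of_deg_lt (by rw [hm]; exact_mod_cast hi)
  -- An upper bound suffices, as `deg F_*` occurs only on the larger side of the rank condition.
  have hF5 : FormalSeries.deg (linearization F) ≤ (5 : ℤ) :=
    FormalSeries.deg_le fun i hi => linearization_eq_zero hF6 (by lia)
  -- For `k ≥ 10` the defect has degree at most `m + 5 - k ≤ m - 5`, while `m + 4 - s ≥ m - 4` for
  -- `s ≤ 8`.
  have hcoeff : ∀ s : ℤ, 0 ≤ s → s ≤ 8 →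
      jetDefect F m (fun r => L.1 (m - r)) s = 0 := by
    intro s _ hs
    rw [jetDefect, ← coeff_dt_sub_commutator hF6 hLm hs]
    apply FormalSeries.coeff_eq_zero_of_deg_lt
    rw [hm] at hL
    have h1 := hL.trans (add_le_add_right hF5 _)
    revert h1
    generalize FormalSeries.deg (FormalSeries.dt F L -
      FormalSeries.commutator (linearization F) L) = x
    cases x with
    | bot => exact fun _ => WithBot.bot_lt_coe _
    | coe x =>
      intro h1
      norm_cast at h1 ⊢
      lia
  have h0 := eq_zero_of_jetDefect (m := m) (κ := -19 / 360 * b ^ 2) hF hFΦ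
    (congrFun (pd_u_topFlow (b ^ 2) hν) 5) (by simp [hb]) (by simp [hb, ha, hm_ne])
    (hasWeight_approxSymmetry m (a / b)) (if_pos rfl)
    (fun s h0 h8 => jetDefect_topFlow m (b ^ 2) hν h0 h8) (jetDefect_topFlow_eight m (b ^ 2) hν)
    (fun r hr => hLm _ (by lia)) hcoeff
  exact hm0 (by simpa using h0)
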